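/- Let $S$ be a set, let $T$ be a finitary monad (one preserving filtered colimits) on the category $\mathbf{Set}^S$ of $S$-sorted sets, and let $\mathcal V$ be the variety of Eilenberg–Moore algebras for $T$. Let $F\colon\mathcal V\to\mathcal V$ be a functor preserving sifted colimits. An object of $\mathcal V$ is called ffg (free finitely generated) if it is isomorphic to a free algebra $(TX_0,\mu_{X_0})$ where $X_0$ is an $S$-sorted set such that $\coprod_{s\in S}(X_0)_s$ is finite. An ffg-equation is a morphism $e\colon X\to FX+A$ of $\mathcal V$ with $X$ ffg and $A$ arbitrary. For $h\colon A\to B$ put $h\bullet e=(FX+h)\cdot e\colon X\to FX+B$. For ffg-equations $e\colon X\to FX+Y$ and $f\colon Y\to FY+A$ put $$e\mathbin{\square}f=\Bigl(X+Y\xrightarrow{[e,\mathsf{inr}]}FX+Y\xrightarrow{FX+f}FX+FY+A\xrightarrow{[F\mathsf{inl},F\mathsf{inr}]+A}F(X+Y)+A\Bigr).$$ An ffg-Elgot algebra for $F$ is a triple $(A,a,\dagger)$ consisting of an $F$-algebra $a\colon FA\to A$ and an operation $\dagger$ assigning to every ffg-equation $e\colon X\to FX+A$ a morphism $e^\dagger\colon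 X\to A$ such that: 1. (Solution) $e^\dagger=[a,\mathrm{id}_A]\cdot(Fe^\dagger+A)\cdot e$ for every ffg-equation $e\colon X\to FX+A$. 2. (Weak Functoriality) For all ffg objects $X,Y,Z$, all ffg-equations $e\colon X\to FX+Z$ and $f\colon Y\to FY+Z$, and every $m\colon X\to Y$ with $(Fm+Z)\cdot e=f\cdot m$, one has $(h\bullet f)^\dagger\cdot m=(h\bullet e)^\dagger$ for every $h\colon Z\to A$. 3. (Compositionality) For all ffg objects $X,Y$ and all ffg-equations $e\colon X\to FX+Y$ and $f\colon Y\to FY+A$, one has $(f^\dagger\bullet e)^\dagger=(e\mathbin{\square}f)^\dagger\cdot\mathsf{inl}$. A morphism $(A,a,\dagger)\to(B,b,\ddagger)$ of ffg-Elgot algebras is a morphism $h\colon A\to B$ of $\mathcal V$ such that $(h\bullet e)^\ddagger=h\cdot e^\dagger$ for every ffg-equation $e\colon X\to FX+A$. These form a category, with forgetful functor $U_F\colon(A,a,\dagger)\mapsto A$ to $\mathcal V$. **Theorem.** The functor $U_F$ from the category of ffg-Elgot algebras for $F$ to $\mathcal V$ is monadic: it has a left adjoint, and the comparison functor to the category of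 Eilenberg–Moore algebras of the induced monad on $\mathcal V$ is an equivalence. -/

import Mathlib

open CategoryTheory Limits

universe u

namespace FfgElgot

/-! ### Varieties

A (finitary, `S`-sorted) variety is the category `T.Algebra` of Eilenberg-Moore algebras of a
finitary monad `T` on the category `S → Type u` of `S`-sorted sets. -/

section Cocomplete

variable {S : Type u} (T : Monad (S → Type u))

instance sortedSet_hasLimits : HasLimitsOfSize.{u, u} (S → Type u) where
  has_limits_of_shape _ _ :=
    { has_limit := fun _ => CategoryTheory.pi.hasLimit_of_hasLimit_comp_eval }

instance sortedSet_hasColimits : HasColimitsOfSize.{u, u} (S → Type u) where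
  has_colimits_of_shape _ _ :=
    { has_colimit := fun _ => CategoryTheory.pi.hasColimit_of_hasColimit_comp_eval }

instance algebra_hasLimits : HasLimitsOfSize.{u, u} T.Algebra where
  has_limits_of_shape _ _ :=
    { has_limit := fun D => Monad.hasLimit_of_comp_forget_hasLimit D }

/-- Every morphism of sorted sets factors as a split epimorphism onto a quotient of its domain,
followed by a monomorphism. -/
theorem exists_quotient_factorization {X Y : S → Type u} (g : X ⟶ Y) :
    ∃ (r : ∀ s, Setoid (X s)) (p : X ⟶ fun s => Quotient (r s))
      (q : (fun s => Quotient (r s)) ⟶ X) (i : (fun s => Quotient (r s)) ⟶ Y),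
      q ≫ p = 𝟙 _ ∧ p ≫ i = g ∧ Mono i := by
  refine ⟨fun s => Setoid.ker (g s), fun s => TypeCat.ofHom (fun x => Quotient.mk _ x),
    fun s => TypeCat.ofHom Quotient.out,
    fun s => TypeCat.ofHom (fun z => Quotient.lift (g s) (fun _ _ h => h) z), ?_, ?_, ?_⟩
  · funext s
    ext z
    exact Quotient.out_eq z
  · funext s
    ext x
    rfl
  · constructor
    intro Z a b h
    funext s
    have hs := congrFun h s
    ext z
    have hz := ConcreteCategory.congr_hom hs z
    have hinj : ∀ x y : Quotient (Setoid.ker (g s)),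
        Quotient.lift (g s) (fun _ _ h => h) x = Quotient.lift (g s) (fun _ _ h => h) y →
          x = y := by
      rintro ⟨x⟩ ⟨y⟩ hxy
      exact Quotient.sound hxy
    exact hinj _ _ hz

theorem const_solutionSet (J : Type u) [SmallCategory J] :
    SolutionSetCondition.{u} (Functor.const J : T.Algebra ⥤ J ⥤ T.Algebra) := by
  intro D
  let X : S → Type u := fun s => Σ j : J, (D.obj j).A s
  let TX : S → Type u := (T : (S → Type u) ⥤ (S → Type u)).obj X
  let Q (r : ∀ s, Setoid (TX s)) : S → Type u := fun s => Quotient (r s)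
  let ι₀ : Type u := Σ (r : ∀ s, Setoid (TX s)),
    { a : (T : (S → Type u) ⥤ (S → Type u)).obj (Q r) ⟶ Q r //
      T.η.app (Q r) ≫ a = 𝟙 (Q r) ∧
      T.μ.app (Q r) ≫ a = (T : (S → Type u) ⥤ (S → Type u)).map a ≫ a }
  let B₀ : ι₀ → T.Algebra := fun k => ⟨Q k.1, k.2.1, k.2.2.1, k.2.2.2⟩
  refine ⟨Σ k : ι₀, (D ⟶ (Functor.const J).obj (B₀ k)), fun k => B₀ k.1, fun k => k.2, ?_⟩
  intro C h
  let inj (j : J) : (D.obj j).A ⟶ X := fun s => TypeCat.ofHom (fun x => ⟨j, x⟩)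
  let g : X ⟶ C.A := fun s => TypeCat.ofHom (fun x => (h.app x.1).f s x.2)
  have hg (j : J) : inj j ≫ g = (h.app j).f := by
    funext s
    ext x
    rfl
  let G : TX ⟶ C.A := (T : (S → Type u) ⥤ (S → Type u)).map g ≫ C.a
  have hηG : T.η.app X ≫ G = g := by
    have := T.η.naturality g
    simp only [G]
    rw [← Category.assoc, ← this, Functor.id_map, Category.assoc, C.unit]
    exact Category.comp_id g
  have hμG : T.μ.app X ≫ G = (T : (S → Type u) ⥤ (S → Type u)).map G ≫ C.a := by
    have := T.μ.naturality g
    simp only [G, Functor.map_comp, Category.assoc]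
    rw [← C.assoc, ← Category.assoc, ← this, Category.assoc]
    rfl
  obtain ⟨r, p, q, i, hqp, hpi, hi⟩ := exists_quotient_factorization G
  have hqG : q ≫ G = i := by rw [← hpi, ← Category.assoc, hqp, Category.id_comp]
  let a : (T : (S → Type u) ⥤ (S → Type u)).obj (Q r) ⟶ Q r :=
    (T : (S → Type u) ⥤ (S → Type u)).map q ≫ T.μ.app X ≫ p
  have ha : a ≫ i = (T : (S → Type u) ⥤ (S → Type u)).map i ≫ C.a := by
    simp only [a, Category.assoc]
    rw [hpi, hμG, ← Category.assoc, ← Functor.map_comp, hqG]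
  have hunit : T.η.app (Q r) ≫ a = 𝟙 (Q r) := by
    rw [← cancel_mono i, Category.assoc, ha, ← Category.assoc, ← T.η.naturality i,
      Category.assoc, C.unit]
    simp
  have hassoc : T.μ.app (Q r) ≫ a = (T : (S → Type u) ⥤ (S → Type u)).map a ≫ a := by
    rw [← cancel_mono i, Category.assoc, ha, Category.assoc, ha, ← Category.assoc,
      ← Category.assoc, ← Functor.map_comp, ha, ← T.μ.naturality i, Category.assoc, C.assoc,
      Functor.map_comp, Category.assoc]
    rfl
  let k : ι₀ := ⟨r, a, hunit, hassoc⟩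
  have hcancel {Z : S → Type u} (x y : Z ⟶ Q r) (hxy : x ≫ i = y ≫ i) : x = y :=
    (cancel_mono i).1 hxy
  let l (j : J) : D.obj j ⟶ B₀ k :=
    { f := inj j ≫ T.η.app X ≫ p
      h := by
        have e1 : (inj j ≫ T.η.app X ≫ p) ≫ i = (h.app j).f := by
          rw [Category.assoc, Category.assoc, hpi, hηG, hg]
        change _ ≫ a = _ ≫ (inj j ≫ T.η.app X ≫ p)
        rw [← cancel_mono i, Category.assoc, ha, ← Category.assoc, ← Functor.map_comp, e1,
          Category.assoc, e1]
        exact (h.app j).h }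
  have hl (j : J) : (l j).f ≫ i = (h.app j).f := by
    change (inj j ≫ T.η.app X ≫ p) ≫ i = _
    rw [Category.assoc, Category.assoc, hpi, hηG, hg]
  let m : B₀ k ⟶ C := { f := i, h := ha.symm }
  let L : D ⟶ (Functor.const J).obj (B₀ k) :=
    { app := l
      naturality := by
        intro j j' φ
        apply Monad.Algebra.Hom.ext'
        have hn := congrArg Monad.Algebra.Hom.f (h.naturality φ)
        change (D.map φ).f ≫ (h.app j').f = (h.app j).f ≫ 𝟙 _ at hn
        rw [Category.comp_id] at hn
        refine Eq.trans ?_ (Category.comp_id (l j).f).symm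
        refine hcancel _ _ ?_
        refine (Category.assoc (D.map φ).f (l j').f i).trans ?_
        rw [hl, hn]
        exact (hl j).symm }
  refine ⟨⟨k, L⟩, m, ?_⟩
  apply NatTrans.ext
  funext j
  exact Monad.Algebra.Hom.ext (hl j)

instance algebra_hasColimits : HasColimitsOfSize.{u, u} T.Algebra where
  has_colimits_of_shape J _ :=
    hasColimitsOfShape_iff_isRightAdjoint_const.2
      (isRightAdjoint_of_preservesLimits_of_solutionSetCondition _ (const_solutionSet T J))

end Cocomplete

/-! ### Free finitely generated objects -/

section Ffg

variable {S : Type u} {T : Monad (S → Type u)}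

/-- An object of the variety is ffg if it is (isomorphic to) the free algebra `(T X₀, μ)` on a
finite `S`-sorted set `X₀`, i.e. one whose disjoint union of components is finite. -/
def IsFfg (X : T.Algebra) : Prop :=
  ∃ X₀ : S → Type u, Finite (Σ s, X₀ s) ∧ Nonempty (X ≅ T.free.obj X₀)

/-- The coproduct of sorted sets as a disjoint union. -/
def sumCofan (X Y : S → Type u) : BinaryCofan X Y :=
  BinaryCofan.mk (P := fun s => X s ⊕ Y s)
    (fun _ => TypeCat.ofHom Sum.inl) (fun _ => TypeCat.ofHom Sum.inr)

def sumCofanIsColimit (X Y : S → Type u) : IsColimit (sumCofan X Y) :=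
  BinaryCofan.isColimitMk
    (fun c s => TypeCat.ofHom (Sum.elim (c.inl s) (c.inr s)))
    (fun c => by funext s; ext x; rfl) (fun c => by funext s; ext x; rfl)
    (fun c m h₁ h₂ => by
      funext s
      ext x
      cases x with
      | inl x => exact ConcreteCategory.congr_hom (congrFun h₁ s) x
      | inr x => exact ConcreteCategory.congr_hom (congrFun h₂ s) x)

theorem IsFfg.coprod {X Y : T.Algebra} (hX : IsFfg X) (hY : IsFfg Y) : IsFfg (X ⨿ Y) := by
  obtain ⟨X₀, hX₀, ⟨i⟩⟩ := hX
  obtain ⟨Y₀, hY₀, ⟨j⟩⟩ := hY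
  refine ⟨fun s => X₀ s ⊕ Y₀ s, Finite.of_equiv _ (Equiv.sigmaSumDistrib X₀ Y₀).symm, ⟨?_⟩⟩
  have : T.free.IsLeftAdjoint := T.adj.isLeftAdjoint
  have : PreservesColimit (pair X₀ Y₀) T.free :=
    (T.adj.leftAdjoint_preservesColimits.preservesColimitsOfShape).preservesColimit
  exact coprod.mapIso i j ≪≫
    (colimit.isColimit _).coconePointUniqueUpToIso
      (mapIsColimitOfPreservesOfIsColimit T.free _ _ (sumCofanIsColimit X₀ Y₀))

end Ffg

/-! ### ffg-Elgot algebras -/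

section Elgot

variable {S : Type u} {T : Monad (S → Type u)} (F : T.Algebra ⥤ T.Algebra)

/-- `h • e = (X ⟶ F X + A ⟶ F X + B)` for `e : X ⟶ F X + A` and `h : A ⟶ B`. -/
noncomputable def bullet {X A B : T.Algebra} (h : A ⟶ B) (e : X ⟶ F.obj X ⨿ A) :
    X ⟶ F.obj X ⨿ B :=
  e ≫ coprod.map (𝟙 (F.obj X)) h

/-- `e □ f = (X + Y ⟶ F X + Y ⟶ F X + F Y + A ⟶ F (X + Y) + A)`, the consecutive arrows being
`[e, inr]`, `F X + f` and `[F inl, F inr] + A`. -/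
noncomputable def square {X Y A : T.Algebra} (e : X ⟶ F.obj X ⨿ Y) (f : Y ⟶ F.obj Y ⨿ A) :
    X ⨿ Y ⟶ F.obj (X ⨿ Y) ⨿ A :=
  coprod.desc e coprod.inr ≫ coprod.map (𝟙 (F.obj X)) f ≫
    (coprod.associator (F.obj X) (F.obj Y) A).inv ≫
      coprod.map (coprod.desc (F.map coprod.inl) (F.map coprod.inr)) (𝟙 A)

end Elgot

end FfgElgot

open FfgElgot in
/-- An ffg-Elgot algebra for `F`: an `F`-algebra with carrier `a` and structure `str`, and an
operation `sol` assigning a solution to every ffg-equation with parameters in `a`, subject to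
weak functoriality and compositionality. -/
structure FfgElgotAlgebra {S : Type u} {T : Monad (S → Type u)} (F : T.Algebra ⥤ T.Algebra)
    extends Endofunctor.Algebra F where
  sol : ∀ {X : T.Algebra}, IsFfg X → (X ⟶ F.obj X ⨿ a) → (X ⟶ a)
  sol_eq : ∀ {X : T.Algebra} (hX : IsFfg X) (e : X ⟶ F.obj X ⨿ a),
    sol hX e = e ≫ coprod.map (F.map (sol hX e)) (𝟙 a) ≫ coprod.desc str (𝟙 a)
  weak_functoriality : ∀ {X Y Z : T.Algebra} (hX : IsFfg X) (hY : IsFfg Y) (_ : IsFfg Z)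
    (e : X ⟶ F.obj X ⨿ Z) (f : Y ⟶ F.obj Y ⨿ Z) (m : X ⟶ Y),
    e ≫ coprod.map (F.map m) (𝟙 Z) = m ≫ f →
    ∀ h : Z ⟶ a, m ≫ sol hY (bullet F h f) = sol hX (bullet F h e)
  compositionality : ∀ {X Y : T.Algebra} (hX : IsFfg X) (hY : IsFfg Y)
    (e : X ⟶ F.obj X ⨿ Y) (f : Y ⟶ F.obj Y ⨿ a),
    sol hX (bullet F (sol hY f) e) = coprod.inl ≫ sol (hX.coprod hY) (square F e f)

namespace FfgElgotAlgebra

open FfgElgot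

variable {S : Type u} {T : Monad (S → Type u)} {F : T.Algebra ⥤ T.Algebra}

/-- Morphisms of ffg-Elgot algebras: solution-preserving morphisms of the variety. -/
@[ext]
structure Hom (A B : FfgElgotAlgebra F) where
  f : A.a ⟶ B.a
  preserves : ∀ {X : T.Algebra} (hX : IsFfg X) (e : X ⟶ F.obj X ⨿ A.a),
    B.sol hX (bullet F f e) = A.sol hX e ≫ f

instance category : Category (FfgElgotAlgebra F) where
  Hom := Hom
  id A := ⟨𝟙 A.a, fun hX e => by simp [bullet]⟩
  comp g h := ⟨g.f ≫ h.f, fun hX e => by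
    have hc : bullet F (g.f ≫ h.f) e = bullet F h.f (bullet F g.f e) := by simp [bullet]
    rw [hc, h.preserves, g.preserves, Category.assoc]⟩
  id_comp g := Hom.ext (Category.id_comp g.f)
  comp_id g := Hom.ext (Category.comp_id g.f)
  assoc g h k := Hom.ext (Category.assoc g.f h.f k.f)

/-- The forgetful functor `U_F` from ffg-Elgot algebras for `F` to the variety. -/
def forget (F : T.Algebra ⥤ T.Algebra) : FfgElgotAlgebra F ⥤ T.Algebra where
  obj A := A.a
  map g := g.f

end FfgElgotAlgebra

/-!
The forgetful functor `U_F` satisfies the hypotheses of Beck's monadicity theorem, its left adjoint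
being supplied by the general adjoint functor theorem.

*Finiteness.* Since `F` and `F X + (-)` preserve sifted colimits, a map from an ffg object `W` into
`G A`, for `G` either of these functors, factors through `G Y` for some map `Y ⟶ A` from an ffg
object (`IsFfg.exists_factor_map`). Indeed `A` is a quotient of the free algebra on its underlying
sorted set, a reflexive coequalizer; `W` is projective with respect to strong epimorphisms; and the
free algebra is the directed union of the free algebras on finite sets of generators. There are two
consequences. Every ffg-equation has the form `h • e` with `e` having ffg parameters, so that weak
functoriality makes solutions invariant under renaming of variables (`sol_rename`). And
solution-preserving morphisms are morphisms of `F`-algebras (`Hom.map_str`): for `w : W ⟶ F Y` and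
`y : Y ⟶ A`, the value of the structure map at `F y ∘ w` is a component of the solution of the
equation `W + Y ⟶ F (W + Y) + A` given by `w` and `y`.

*Limits and split coequalizers.* A jointly monic family of maps into ffg-Elgot algebras whose domain
is compatible with structure maps and solutions induces an ffg-Elgot algebra (`ofJointlyMono`), so
limits are formed in the variety. On a coequalizer `π : B ⟶ C` that is split by `s : C ⟶ B`, the
solution of `e` is `π ∘ (s • e)†` (`coequalizerAlgebra`).

*The solution set.* Given `h : Y ⟶ A`, let `P₀ = Y` and let `Pₙ₊₁` be the coproduct of `Pₙ`, of
`F Pₙ`, and of the variables of all ffg-equations with parameters in `Pₙ` (over representatives of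
the ffg objects). The union `P` of this chain depends on `Y` only. The structure map and the
solutions of `A` yield a map `P ⟶ A`, and its image is closed under both of them (`exists_str`,
`exists_sol`): an equation with parameters in the image lifts to `P`, hence to some `Pₙ`, and its
solution is interpreted by `Pₙ₊₁`. So every `h` factors through an ffg-Elgot algebra carried by a
quotient of `P`; up to isomorphism these form a set, because an ffg-Elgot algebra is determined, as
far as morphisms are concerned, by its solutions of equations over the representatives.
-/

open CategoryTheory Limits

namespace FfgElgot

/-! ### Reflexive pairs are sifted -/

section Sifted

open WalkingReflexivePair WalkingReflexivePair.Hom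

/-- The cospan `c₁ ⟶ j ⟵ c₂` as an object over the diagonal. -/
def cospanArrow {C : Type*} [Category C] {c₁ c₂ j : C} (f : c₁ ⟶ j) (g : c₂ ⟶ j) :
    StructuredArrow ((c₁, c₂) : C × C) (Functor.diag C) :=
  StructuredArrow.mk (Y := j) ⟨f, g⟩

theorem zag_cospanArrow {C : Type*} [Category C] {c₁ c₂ j k : C} (f : c₁ ⟶ j) (g : c₂ ⟶ j)
    (h : j ⟶ k) : Zag (cospanArrow f g) (cospanArrow (f ≫ h) (g ≫ h)) :=
  Zag.of_hom (StructuredArrow.homMk h rfl)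

theorem WalkingReflexivePair.eq_left_or_eq_right
    (f : WalkingReflexivePair.one ⟶ WalkingReflexivePair.zero) :
    f = left ∨ f = right := by
  change WalkingReflexivePair.Hom _ _ at f
  cases f
  · exact Or.inl rfl
  · exact Or.inr rfl

theorem WalkingReflexivePair.eq_id
    (f : WalkingReflexivePair.zero ⟶ WalkingReflexivePair.zero) : f = 𝟙 _ := by
  change WalkingReflexivePair.Hom _ _ at f
  cases f
  rfl

/-- If `c₁` is `one`, then `left` and `right` are both obtained from the identity of `one`, and
composing with the reflexion first makes this leave the other leg alone. -/
theorem zigzag_cospanArrow_left {c₁ c₂ : WalkingReflexivePair}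
    (f f' : c₁ ⟶ WalkingReflexivePair.zero) (g : c₂ ⟶ WalkingReflexivePair.zero) :
    Zigzag (cospanArrow f g) (cospanArrow f' g) := by
  cases c₁ with
  | zero =>
    rw [WalkingReflexivePair.eq_id f, WalkingReflexivePair.eq_id f']
  | one =>
    have hc : ∀ f, Zigzag (cospanArrow (𝟙 WalkingReflexivePair.one) (g ≫ reflexion))
        (cospanArrow f g) := by
      intro f
      have := zag_cospanArrow (𝟙 WalkingReflexivePair.one) (g ≫ reflexion) f
      rw [Category.id_comp, Category.assoc] at this
      have h : (reflexion : WalkingReflexivePair.zero ⟶ _) ≫ f = 𝟙 _ := by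
        obtain rfl | rfl := WalkingReflexivePair.eq_left_or_eq_right f <;> rfl
      rw [h, Category.comp_id] at this
      exact Zigzag.of_zag this
    exact (hc f).symm.trans (hc f')

theorem zigzag_cospanArrow_right {c₁ c₂ : WalkingReflexivePair}
    (f : c₁ ⟶ WalkingReflexivePair.zero) (g g' : c₂ ⟶ WalkingReflexivePair.zero) :
    Zigzag (cospanArrow f g) (cospanArrow f g') := by
  cases c₂ with
  | zero =>
    rw [WalkingReflexivePair.eq_id g, WalkingReflexivePair.eq_id g']
  | one =>
    have hc : ∀ g, Zigzag (cospanArrow (f ≫ reflexion) (𝟙 WalkingReflexivePair.one))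
        (cospanArrow f g) := by
      intro g
      have := zag_cospanArrow (f ≫ reflexion) (𝟙 WalkingReflexivePair.one) g
      rw [Category.id_comp, Category.assoc] at this
      have h : (reflexion : WalkingReflexivePair.zero ⟶ _) ≫ g = 𝟙 _ := by
        obtain rfl | rfl := WalkingReflexivePair.eq_left_or_eq_right g <;> rfl
      rw [h, Category.comp_id] at this
      exact Zigzag.of_zag this
    exact (hc g).symm.trans (hc g')

/-- The shape of reflexive pairs is sifted: any cospan can be moved to one with vertex `zero`, and
there the two legs can be exchanged one at a time using the reflexion. -/
instance isSifted_walkingReflexivePair : IsSifted WalkingReflexivePair where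
  out d := by
    obtain ⟨c₁, c₂⟩ := d
    have toZero : ∀ c : WalkingReflexivePair, Nonempty (c ⟶ WalkingReflexivePair.zero)
      | .zero => ⟨𝟙 _⟩
      | .one => ⟨left⟩
    obtain ⟨z₁⟩ := toZero c₁
    obtain ⟨z₂⟩ := toZero c₂
    have : Nonempty (StructuredArrow (c₁, c₂) (Functor.diag WalkingReflexivePair)) :=
      ⟨cospanArrow z₁ z₂⟩
    have key : ∀ X : StructuredArrow (c₁, c₂) (Functor.diag WalkingReflexivePair),
        Zigzag X (cospanArrow z₁ z₂) := by
      rintro ⟨⟨⟨⟩⟩, j, ⟨f, g⟩⟩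
      obtain ⟨h⟩ := toZero j
      exact (Zigzag.of_zag (zag_cospanArrow f g h)).trans
        ((zigzag_cospanArrow_left _ z₁ _).trans (zigzag_cospanArrow_right _ _ z₂))
    exact zigzag_isConnected fun X Y => (key X).trans (key Y).symm
  nonempty := ⟨.zero⟩

end Sifted

/-! ### Functors preserving sifted colimits -/

section PreservesSifted

universe v₁ v₂ u₁ u₂

variable {C : Type u₁} [Category.{v₁} C] {D : Type u₂} [Category.{v₂} D]

/-- The functor preserves sifted colimits indexed by `u`-small categories. -/
def PreservesSiftedColimits (G : C ⥤ D) : Prop :=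
  ∀ (J : Type u) [SmallCategory J] [IsSifted J], PreservesColimitsOfShape J G

theorem PreservesSiftedColimits.of_small {G : C ⥤ D} (hG : PreservesSiftedColimits.{u} G)
    (J : Type) [SmallCategory J] [IsSifted J] : PreservesColimitsOfShape J G :=
  have := IsSifted.isSifted_iff_asSmallIsSifted.{u} (C := J) |>.1 inferInstance
  have := hG (AsSmall.{u} J)
  preservesColimitsOfShape_of_equiv AsSmall.equiv.symm G

/-- Forming the coproduct with a fixed object preserves connected colimits. -/
theorem preservesColimitsOfShape_coprod [HasBinaryCoproducts C] (X : C)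
    (J : Type u) [SmallCategory J] [IsConnected J] :
    PreservesColimitsOfShape J (coprod.functor.obj X) where
  preservesColimit {K} :=
    { preserves := fun {c} hc => ⟨by
        let j₀ : J := Classical.arbitrary J
        let leg (s : Cocone (K ⋙ coprod.functor.obj X)) (j : J) : X ⨿ K.obj j ⟶ s.pt := s.ι.app j
        have hleg (s : Cocone (K ⋙ coprod.functor.obj X)) {j j' : J} (f : j ⟶ j') :
            coprod.map (𝟙 X) (K.map f) ≫ leg s j' = leg s j := s.w f
        -- The first summand is mapped independently of the stage, by connectedness.
        have hinl (s : Cocone (K ⋙ coprod.functor.obj X)) (j j' : J) :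
            coprod.inl ≫ leg s j = coprod.inl ≫ leg s j' := by
          refine constant_of_preserves_morphisms (fun j => coprod.inl ≫ leg s j)
            (fun j j' f => ?_) j j'
          rw [← hleg s f, coprod.inl_map_assoc, Category.id_comp]
        let tail (s : Cocone (K ⋙ coprod.functor.obj X)) : Cocone K :=
          { pt := s.pt
            ι :=
              { app := fun j => coprod.inr ≫ leg s j
                naturality := fun j j' f => by
                  rw [← hleg s f, coprod.inr_map_assoc]
                  exact (Category.comp_id _).symm } }
        have htail (s : Cocone (K ⋙ coprod.functor.obj X)) (j : J) :
            c.ι.app j ≫ hc.desc (tail s) = coprod.inr ≫ leg s j := hc.fac (tail s) j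
        exact
          { desc := fun s => coprod.desc (coprod.inl ≫ leg s j₀) (hc.desc (tail s))
            fac := fun s j => by
              change coprod.map (𝟙 X) (c.ι.app j) ≫ _ = leg s j
              apply coprod.hom_ext
              · rw [coprod.inl_map_assoc, Category.id_comp, coprod.inl_desc, hinl]
              · rw [coprod.inr_map_assoc, coprod.inr_desc, htail]
            uniq := fun s (m : X ⨿ c.pt ⟶ s.pt) hm => by
              have hm' (j : J) : coprod.map (𝟙 X) (c.ι.app j) ≫ m = leg s j := hm j
              apply coprod.hom_ext
              · rw [coprod.inl_desc, ← hm' j₀, coprod.inl_map_assoc, Category.id_comp]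
                rfl
              · rw [coprod.inr_desc]
                refine hc.hom_ext fun j => ?_
                rw [htail, ← hm' j, coprod.inr_map_assoc]
                rfl }⟩ }

/-- Forming the coproduct with a fixed object preserves sifted colimits, since sifted categories are
connected. -/
theorem preservesSiftedColimits_coprod [HasBinaryCoproducts C] (X : C) :
    PreservesSiftedColimits.{u} (coprod.functor.obj X) :=
  fun J _ _ => preservesColimitsOfShape_coprod X J

end PreservesSifted

/-! ### Regular epimorphisms and images in a variety -/

section Images

variable {S : Type u} {T : Monad (S → Type u)}

/-- The underlying sorted set of a kernel pair is a kernel pair of sorted sets. -/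
theorem exists_lift_pullback {P B : T.Algebra} (q : P ⟶ B) {Z : S → Type u} (x y : Z ⟶ P.A)
    (h : x ≫ q.f = y ≫ q.f) :
    ∃ l : Z ⟶ (pullback q q).A, l ≫ (pullback.fst q q).f = x ∧ l ≫ (pullback.snd q q).f = y := by
  let hl := isLimitPullbackConeMapOfIsLimit T.forget pullback.condition (pullbackIsPullback q q)
  exact ⟨_, PullbackCone.IsLimit.lift_fst hl x y h, PullbackCone.IsLimit.lift_snd hl x y h⟩

/-- A morphism of algebras that splits on underlying sorted sets is the coequalizer of its kernel
pair. -/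
theorem nonempty_isColimit_kernelPair {P B : T.Algebra} (q : P ⟶ B) (s : B.A ⟶ P.A)
    (hs : s ≫ q.f = 𝟙 _) :
    Nonempty (IsColimit (Cofork.ofπ q pullback.condition)) := by
  have hT : T.toFunctor.map s ≫ T.toFunctor.map q.f = 𝟙 _ := by
    rw [← Functor.map_comp, hs, CategoryTheory.Functor.map_id]
  -- A map coequalizing the kernel pair identifies an element with its chosen representative.
  have hq {Z : T.Algebra} (k : P ⟶ Z) (hk : pullback.fst q q ≫ k = pullback.snd q q ≫ k) :
      q.f ≫ s ≫ k.f = k.f := by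
    obtain ⟨l, h₁, h₂⟩ := exists_lift_pullback q (q.f ≫ s) (𝟙 _)
      (by rw [Category.assoc, hs, Category.comp_id, Category.id_comp])
    have := congrArg (fun t => l ≫ Monad.Algebra.Hom.f t) hk
    simp only [Monad.Algebra.comp_f] at this
    rw [← Category.assoc, ← Category.assoc, h₁, h₂, Category.id_comp, Category.assoc] at this
    exact this
  refine ⟨Cofork.IsColimit.mk' _ fun c => ⟨⟨s ≫ c.π.f, ?_⟩, ?_, ?_⟩⟩
  -- The descended map is a morphism of algebras because `T q` is a split epimorphism.
  · have hc := hq c.π c.condition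
    have hq' := q.h
    have hk' := c.π.h
    have e1 : T.toFunctor.map q.f ≫ T.toFunctor.map (s ≫ c.π.f) = T.toFunctor.map c.π.f := by
      rw [← Functor.map_comp, hc]
    have e2 : T.toFunctor.map q.f ≫ B.a ≫ s ≫ c.π.f = P.a ≫ c.π.f := by
      rw [← Category.assoc, hq', Category.assoc, hc]
    calc T.toFunctor.map (s ≫ c.π.f) ≫ _
        = T.toFunctor.map s ≫ T.toFunctor.map q.f ≫ T.toFunctor.map (s ≫ c.π.f) ≫ c.pt.a := by
          rw [← Category.assoc (T.toFunctor.map s), hT, Category.id_comp]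
      _ = T.toFunctor.map s ≫ T.toFunctor.map q.f ≫ B.a ≫ s ≫ c.π.f := by
          rw [e2, ← Category.assoc (T.toFunctor.map q.f), e1]
          exact congrArg _ hk'
      _ = _ := by
          rw [← Category.assoc (T.toFunctor.map s), hT, Category.id_comp]
          rfl
  · apply Monad.Algebra.Hom.ext'
    exact hq c.π c.condition
  · intro m hm
    apply Monad.Algebra.Hom.ext'
    have hm' : q.f ≫ m.f = c.π.f := congrArg Monad.Algebra.Hom.f hm
    change m.f = s ≫ c.π.f
    rw [← hm', ← Category.assoc, hs]
    exact (Category.id_comp m.f).symm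

/-- Functors preserving sifted colimits preserve quotients, since the latter are reflexive
coequalizers. -/
theorem strongEpi_map {C : Type*} [Category C] {G : T.Algebra ⥤ C}
    (hG : PreservesSiftedColimits.{u} G) {P B : T.Algebra} (q : P ⟶ B) (s : B.A ⟶ P.A)
    (hs : s ≫ q.f = 𝟙 _) : StrongEpi (G.map q) := by
  obtain ⟨hc⟩ := nonempty_isColimit_kernelPair q s hs
  have := hG.of_small WalkingReflexivePair
  let D := reflexivePair (pullback.fst q q) (pullback.snd q q)
    (pullback.lift (𝟙 P) (𝟙 P) rfl) (pullback.lift_fst _ _ _) (pullback.lift_snd _ _ _)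
  let R : ReflexiveCofork D := ReflexiveCofork.mk q pullback.condition
  have hR : IsColimit R := ReflexiveCofork.isColimitEquiv D R hc
  have hGR := isColimitOfPreserves G hR
  have : IsRegularEpi (G.map q) := isRegularEpi_of_regularEpi
    (Cofork.IsColimit.regularEpi
      ((ReflexiveCofork.isColimitEquiv (D ⋙ G) (G.mapCocone R)).symm hGR))
  infer_instance

theorem preservesSiftedColimits_id {C : Type*} [Category C] :
    PreservesSiftedColimits.{u} (𝟭 C) := fun _ _ _ => inferInstance

theorem strongEpi_of_section {P B : T.Algebra} (q : P ⟶ B) (s : B.A ⟶ P.A)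
    (hs : s ≫ q.f = 𝟙 _) : StrongEpi q :=
  strongEpi_map preservesSiftedColimits_id q s hs

/-- The quotients of an algebra, presented by an equivalence relation on its underlying sorted set
together with an algebra structure on the set of classes. They form a `u`-small set, and the
projection is not required to be a morphism. -/
def QuotAlgebra (P : T.Algebra) : Type u :=
  Σ (r : ∀ s, Setoid (P.A s)),
    { a : T.toFunctor.obj (fun s => Quotient (r s) : S → Type u) ⟶ (fun s => Quotient (r s)) //
      T.η.app _ ≫ a = 𝟙 _ ∧ T.μ.app _ ≫ a = T.toFunctor.map a ≫ a }

/-- The quotient algebra with a given presentation. -/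
def QuotAlgebra.toAlgebra {P : T.Algebra} (k : QuotAlgebra P) : T.Algebra :=
  ⟨fun s => Quotient (k.1 s), k.2.1, k.2.2.1, k.2.2.2⟩

/-- Every morphism of algebras factors as a morphism with underlying split epimorphism, onto one
of the chosen quotients, followed by a monomorphism. -/
theorem exists_image {P C : T.Algebra} (g : P ⟶ C) :
    ∃ (k : QuotAlgebra P) (q : P ⟶ k.toAlgebra) (s : k.toAlgebra.A ⟶ P.A) (i : k.toAlgebra ⟶ C),
      s ≫ q.f = 𝟙 _ ∧ q ≫ i = g ∧ Mono i := by
  obtain ⟨r, p, s, i, hsp, hpi, hi⟩ := exists_quotient_factorization g.f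
  have hsG : s ≫ g.f = i := by rw [← hpi, ← Category.assoc, hsp, Category.id_comp]
  let a := T.toFunctor.map s ≫ P.a ≫ p
  have ha : a ≫ i = T.toFunctor.map i ≫ C.a := by
    simp only [a, Category.assoc]
    rw [hpi, ← g.h, ← Category.assoc, ← Functor.map_comp, hsG]
  have hcancel {Z : S → Type u} (x y : Z ⟶ fun s => Quotient (r s)) (hxy : x ≫ i = y ≫ i) :
      x = y := (cancel_mono i).1 hxy
  have hunit : T.η.app _ ≫ a = 𝟙 _ := by
    apply hcancel
    have := T.η.naturality i
    rw [Category.assoc, ha, ← Category.assoc, ← this, Category.assoc, C.unit]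
    exact (Category.comp_id i).trans (Category.id_comp i).symm
  have hassoc : T.μ.app _ ≫ a = T.toFunctor.map a ≫ a := by
    apply hcancel
    have := T.μ.naturality i
    rw [Category.assoc, ha, Category.assoc, ha, ← Category.assoc,
      ← Category.assoc, ← Functor.map_comp, ha, ← this, Category.assoc, C.assoc,
      Functor.map_comp, Category.assoc]
    rfl
  have hp : T.toFunctor.map p ≫ a = P.a ≫ p := by
    apply hcancel
    rw [Category.assoc, ha, ← Category.assoc, ← Functor.map_comp, hpi, g.h, Category.assoc, hpi]
  let k : QuotAlgebra P := ⟨r, a, hunit, hassoc⟩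
  let m : k.toAlgebra ⟶ C := { f := i, h := ha.symm }
  have : Mono m.f := hi
  have hm : Mono m := T.forget.mono_of_mono_map this
  refine ⟨k, ⟨p, hp⟩, s, m, hsp, Monad.Algebra.Hom.ext hpi, hm⟩

/-- Strong epimorphisms of algebras are surjective, i.e. split on underlying sorted sets. -/
theorem exists_section {P B : T.Algebra} (q : P ⟶ B) [StrongEpi q] :
    ∃ s : B.A ⟶ P.A, s ≫ q.f = 𝟙 _ := by
  obtain ⟨k, p, s, i, hs, rfl, hi⟩ := exists_image q
  have : StrongEpi i := strongEpi_of_strongEpi p i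
  have : IsIso i := isIso_of_mono_of_strongEpi i
  refine ⟨(inv i).f ≫ s, ?_⟩
  have h := congrArg Monad.Algebra.Hom.f (IsIso.inv_hom_id i)
  rw [Monad.Algebra.comp_f, Category.assoc, reassoc_of% hs]
  exact h

/-- An ffg object has a finite sorted set of free generators. -/
theorem IsFfg.exists_generators {W : T.Algebra} (hW : IsFfg W) :
    ∃ (X₀ : S → Type u) (g : X₀ ⟶ W.A), Finite (Σ s, X₀ s) ∧
      ∀ (B : T.Algebra) (x : X₀ ⟶ B.A), ∃! w : W ⟶ B, g ≫ w.f = x := by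
  obtain ⟨X₀, hX₀, ⟨φ⟩⟩ := hW
  let g : X₀ ⟶ W.A := T.adj.homEquiv X₀ W φ.inv
  refine ⟨X₀, g, hX₀, fun B x => ?_⟩
  have key (w : W ⟶ B) : g ≫ w.f =
      T.adj.homEquiv X₀ B (φ.inv ≫ w) := (T.adj.homEquiv_naturality_right φ.inv w).symm
  refine ⟨φ.hom ≫ (T.adj.homEquiv X₀ B).symm x, ?_, fun w hw => ?_⟩
  · dsimp only
    rw [key, Iso.inv_hom_id_assoc]
    exact (T.adj.homEquiv X₀ B).apply_symm_apply x
  · dsimp only at hw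
    rw [key] at hw
    rw [← hw, Equiv.symm_apply_apply, Iso.hom_inv_id_assoc]

/-- Free objects are projective with respect to strong epimorphisms. -/
theorem IsFfg.exists_hom_lift {W P B : T.Algebra} (hW : IsFfg W) (q : P ⟶ B) [StrongEpi q]
    (w : W ⟶ B) : ∃ w' : W ⟶ P, w' ≫ q = w := by
  obtain ⟨X₀, g, -, hg⟩ := hW.exists_generators
  obtain ⟨s, hs⟩ := exists_section q
  obtain ⟨w', hw', -⟩ := hg P ((g ≫ w.f) ≫ s)
  refine ⟨w', (hg B (g ≫ w.f)).unique ?_ rfl⟩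
  calc g ≫ (w' ≫ q).f = (g ≫ w'.f) ≫ q.f := (Category.assoc g w'.f q.f).symm
    _ = (g ≫ w.f) ≫ s ≫ q.f := by rw [hw', Category.assoc]
    _ = g ≫ w.f := by
      rw [hs]
      exact Category.comp_id _

end Images

/-! ### Finite presentability of ffg objects -/

section Finite

variable {S : Type u} {T : Monad (S → Type u)}

theorem preservesColimitsOfShape_eval (J : Type u) [SmallCategory J] (s : S) :
    PreservesColimitsOfShape J (Pi.eval (fun _ : S => Type u) s) where
  preservesColimit {K} := preservesColimit_of_preserves_colimit_cocone
    (pi.coconeOfCoconeEvalIsColimit fun s => colimit.isColimit (K ⋙ Pi.eval _ s))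
    (colimit.isColimit (K ⋙ Pi.eval _ s))

/-- Maps from a finite sorted set into a filtered colimit factor through a stage. -/
theorem exists_factor_sortedSet {X₀ : S → Type u} [Finite (Σ s, X₀ s)] {J : Type u}
    [SmallCategory J] [IsFiltered J] {K : J ⥤ (S → Type u)} {c : Cocone K}
    (hc : IsColimit c) (x : X₀ ⟶ c.pt) :
    ∃ (j : J) (y : X₀ ⟶ K.obj j), y ≫ c.ι.app j = x := by
  have hex (t : Σ s, X₀ s) : ∃ (j : J) (y : K.obj j t.1), c.ι.app j t.1 y = x t.1 t.2 :=
    have := preservesColimitsOfShape_eval J t.1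
    Types.jointly_surjective_of_isColimit
      (isColimitOfPreserves (Pi.eval (fun _ => Type u) t.1) hc) (x t.1 t.2)
  choose j y hy using hex
  classical
  have := Fintype.ofFinite (Σ s, X₀ s)
  obtain ⟨k, hk⟩ := IsFiltered.sup_objs_exists (Finset.univ.image j)
  have f (t : Σ s, X₀ s) : j t ⟶ k := (hk (Finset.mem_image_of_mem j (Finset.mem_univ t))).some
  refine ⟨k, fun s => TypeCat.ofHom (fun z => (K.map (f ⟨s, z⟩)) s (y ⟨s, z⟩)), ?_⟩
  funext s
  ext z
  have hn := ConcreteCategory.congr_hom (congrFun (c.w (f ⟨s, z⟩)) s) (y ⟨s, z⟩)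
  exact hn.trans (hy ⟨s, z⟩)

/-- Maps from an ffg object into a filtered colimit factor through a stage. -/
theorem IsFfg.exists_factor {W : T.Algebra} (hW : IsFfg W) {J : Type u} [SmallCategory J]
    [IsFiltered J] [PreservesColimitsOfShape J T.toFunctor]
    {K : J ⥤ T.Algebra} {c : Cocone K} (hc : IsColimit c) (w : W ⟶ c.pt) :
    ∃ (j : J) (w' : W ⟶ K.obj j), w' ≫ c.ι.app j = w := by
  obtain ⟨X₀, g, hX₀, hg⟩ := hW.exists_generators
  obtain ⟨j, y, hy⟩ := exists_factor_sortedSet (isColimitOfPreserves T.forget hc) (g ≫ w.f)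
  obtain ⟨w', hw', -⟩ := hg (K.obj j) y
  refine ⟨j, w', (hg c.pt (g ≫ w.f)).unique ?_ rfl⟩
  calc g ≫ (w' ≫ c.ι.app j).f = (g ≫ w'.f) ≫ (c.ι.app j).f := (Category.assoc g w'.f _).symm
    _ = y ≫ (c.ι.app j).f := congrArg (· ≫ (c.ι.app j).f) hw'
    _ = g ≫ w.f := hy

/-- The finite sub-sorted-sets of a sorted set. -/
def finiteParts (X : S → Type u) : Finset (Σ s, X s) ⥤ (S → Type u) where
  obj K s := {x : X s // (⟨s, x⟩ : Σ s, X s) ∈ K}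
  map f s := TypeCat.ofHom fun x => ⟨x.1, leOfHom f x.2⟩

/-- The inclusions of the finite parts. -/
def finitePartsCocone (X : S → Type u) : Cocone (finiteParts X) where
  pt := X
  ι := { app := fun _ s => TypeCat.ofHom Subtype.val }

/-- An element of a sorted set, in the finite part consisting of that element. -/
def finitePartsSingle (X : S → Type u) {s : S} (x : X s) : (finiteParts X).obj {⟨s, x⟩} s :=
  ⟨x, Finset.mem_singleton_self _⟩

/-- Every sorted set is the directed union of its finite parts. -/
def finitePartsIsColimit (X : S → Type u) : IsColimit (finitePartsCocone X) where
  desc c s := TypeCat.ofHom fun x =>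
    c.ι.app {⟨s, x⟩} s (finitePartsSingle X x)
  fac c K := by
    funext s
    ext x
    have hle : ({⟨s, x.1⟩} : Finset (Σ s, X s)) ≤ K := Finset.singleton_subset_iff.2 x.2
    exact (ConcreteCategory.congr_hom (congrFun (c.w (homOfLE hle)) s)
      (finitePartsSingle X x.1)).symm
  uniq c m hm := by
    funext s
    ext x
    exact ConcreteCategory.congr_hom (congrFun (hm {⟨s, x⟩}) s)
      (finitePartsSingle X x)

theorem isFfg_free_finiteParts (X : S → Type u) (K : Finset (Σ s, X s)) :
    IsFfg (T.free.obj ((finiteParts X).obj K)) := by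
  refine ⟨_, ?_, ⟨Iso.refl _⟩⟩
  refine Finite.of_injective (β := K)
    (fun t : Σ s, (finiteParts X).obj K s => ⟨⟨t.1, t.2.1⟩, t.2.2⟩) ?_
  rintro ⟨s, x, hx⟩ ⟨s', x', hx'⟩ h
  simp only [Subtype.mk.injEq, Sigma.mk.injEq] at h
  obtain ⟨rfl, h⟩ := h
  obtain rfl := eq_of_heq h
  rfl

/-- If `G` preserves sifted colimits, every map from an ffg object into `G A` factors through
`G Y` for some map `Y ⟶ A` from an ffg object: indeed `A` is a quotient of the free algebra on its
underlying sorted set, which is the directed union of free algebras on finite parts. -/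
theorem IsFfg.exists_factor_map (hT : PreservesFilteredColimitsOfSize.{u, u} T.toFunctor)
    {G : T.Algebra ⥤ T.Algebra} (hG : PreservesSiftedColimits.{u} G) {W A : T.Algebra}
    (hW : IsFfg W) (w : W ⟶ G.obj A) :
    ∃ (Y : T.Algebra) (_ : IsFfg Y) (y : Y ⟶ A) (w' : W ⟶ G.obj Y), w' ≫ G.map y = w := by
  let q : T.free.obj A.A ⟶ A := T.adj.counit.app A
  have := strongEpi_map hG q (T.adj.unit.app A.A) (T.adj.right_triangle_components A)
  obtain ⟨w₁, rfl⟩ := hW.exists_hom_lift (G.map q) w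
  classical
  have : IsSifted (Finset (Σ s, A.A s)) := IsFiltered.isSifted
  have := hG (Finset (Σ s, A.A s))
  have := hT.preserves_filtered_colimits (Finset (Σ s, A.A s))
  have : T.free.IsLeftAdjoint := T.adj.isLeftAdjoint
  obtain ⟨K, w', rfl⟩ := hW.exists_factor
    (isColimitOfPreserves G (isColimitOfPreserves T.free (finitePartsIsColimit A.A))) w₁
  let k : T.free.obj ((finiteParts A.A).obj K) ⟶ T.free.obj A.A :=
    T.free.map ((finitePartsCocone A.A).ι.app K)
  refine ⟨_, isFfg_free_finiteParts A.A K, k ≫ q, w', ?_⟩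
  rw [G.map_comp]
  exact (Category.assoc w' (G.map k) (G.map q)).symm

/-- Morphisms of algebras are determined by their restrictions to ffg objects. -/
theorem hom_ext_ffg {A B : T.Algebra} {x y : A ⟶ B}
    (h : ∀ (W : T.Algebra) (_ : IsFfg W) (w : W ⟶ A), w ≫ x = w ≫ y) : x = y := by
  let q : T.free.obj A.A ⟶ A := T.adj.counit.app A
  have := strongEpi_of_section q (T.adj.unit.app A.A) (T.adj.right_triangle_components A)
  have : T.free.IsLeftAdjoint := T.adj.isLeftAdjoint
  rw [← cancel_epi q]
  refine (isColimitOfPreserves T.free (finitePartsIsColimit A.A)).hom_ext fun K => ?_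
  let k : T.free.obj ((finiteParts A.A).obj K) ⟶ T.free.obj A.A :=
    T.free.map ((finitePartsCocone A.A).ι.app K)
  have := h _ (isFfg_free_finiteParts A.A K) (k ≫ q)
  rwa [Category.assoc, Category.assoc] at this

end Finite

/-! ### Calculus of ffg-equations -/

theorem map_associator_map {C : Type*} [Category C] [HasBinaryCoproducts C] {P Q R Y A B : C}
    (k : P ⨿ Q ⟶ R) (f : Y ⟶ Q ⨿ A) (h : A ⟶ B) :
    coprod.map (𝟙 P) (f ≫ coprod.map (𝟙 Q) h) ≫ (coprod.associator P Q B).inv ≫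
        coprod.map k (𝟙 B) =
      (coprod.map (𝟙 P) f ≫ (coprod.associator P Q A).inv ≫ coprod.map k (𝟙 A)) ≫
        coprod.map (𝟙 R) h := by
  apply coprod.hom_ext
  · simp
  · simp only [coprod.inr_map_assoc, Category.assoc]
    congr 1
    apply coprod.hom_ext <;> simp [coprod.inl_desc, coprod.inr_desc]

section Equations

variable {S : Type u} {T : Monad (S → Type u)} (F : T.Algebra ⥤ T.Algebra)

theorem bullet_bullet {X A B C : T.Algebra} (h : A ⟶ B) (k : B ⟶ C) (e : X ⟶ F.obj X ⨿ A) :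
    bullet F k (bullet F h e) = bullet F (h ≫ k) e := by
  simp [bullet]

theorem bullet_id {X A : T.Algebra} (e : X ⟶ F.obj X ⨿ A) : bullet F (𝟙 A) e = e := by
  simp [bullet]

theorem square_bullet {X Y A B : T.Algebra} (h : A ⟶ B) (e : X ⟶ F.obj X ⨿ Y)
    (f : Y ⟶ F.obj Y ⨿ A) : square F e (bullet F h f) = bullet F h (square F e f) := by
  unfold square bullet
  rw [map_associator_map]
  simp only [Category.assoc]

end Equations

end FfgElgot

namespace FfgElgotAlgebra

open FfgElgot

variable {S : Type u} {T : Monad (S → Type u)} {F : T.Algebra ⥤ T.Algebra}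

/-! ### Solution-preserving morphisms -/

/-- The equation `W + Y ⟶ F (W + Y) + A` with components `w : W ⟶ F Y` and `y : Y ⟶ A`; solving it
evaluates the structure map at `w` after substituting `y`. -/
noncomputable def flatEquation {W Y A : T.Algebra} (w : W ⟶ F.obj Y) (y : Y ⟶ A) :
    W ⨿ Y ⟶ F.obj (W ⨿ Y) ⨿ A :=
  coprod.desc (w ≫ F.map coprod.inr ≫ coprod.inl) (y ≫ coprod.inr)

theorem bullet_flatEquation {W Y A B : T.Algebra} (w : W ⟶ F.obj Y) (y : Y ⟶ A) (h : A ⟶ B) :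
    bullet F h (flatEquation w y) = flatEquation w (y ≫ h) := by
  apply coprod.hom_ext <;> simp [bullet, flatEquation]

theorem inl_sol_flatEquation (A : FfgElgotAlgebra F) {W Y : T.Algebra} (hW : IsFfg W)
    (hY : IsFfg Y) (w : W ⟶ F.obj Y) (y : Y ⟶ A.a) :
    coprod.inl ≫ A.sol (hW.coprod hY) (flatEquation w y) = w ≫ F.map y ≫ A.str := by
  have hr : coprod.inr ≫ A.sol (hW.coprod hY) (flatEquation w y) = y := by
    rw [A.sol_eq, flatEquation, coprod.inr_desc_assoc, Category.assoc, coprod.inr_map_assoc,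
      Category.id_comp, coprod.inr_desc, Category.comp_id]
  rw [A.sol_eq]
  nth_rw 1 [flatEquation]
  rw [coprod.inl_desc_assoc, Category.assoc, Category.assoc, coprod.inl_map_assoc,
    coprod.inl_desc, ← F.map_comp_assoc, hr]

/-- Solution-preserving morphisms are morphisms of `F`-algebras. -/
theorem Hom.map_str (hT : PreservesFilteredColimitsOfSize.{u, u} T.toFunctor)
    (hF : PreservesSiftedColimits.{u} F) {A B : FfgElgotAlgebra F} (g : A ⟶ B) :
    A.str ≫ g.f = F.map g.f ≫ B.str := by
  refine hom_ext_ffg fun W hW w => ?_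
  obtain ⟨Y, hY, y, w', rfl⟩ := hW.exists_factor_map hT hF w
  have h := g.preserves (hW.coprod hY) (flatEquation w' y)
  rw [bullet_flatEquation] at h
  have h' := inl_sol_flatEquation B hW hY w' (y ≫ g.f)
  rw [h, ← Category.assoc, inl_sol_flatEquation A hW hY, F.map_comp] at h'
  simpa only [Category.assoc] using h'

/-- Every ffg-equation arises by substitution from one with ffg parameters. -/
theorem exists_bullet_eq (hT : PreservesFilteredColimitsOfSize.{u, u} T.toFunctor)
    {X A : T.Algebra} (hX : IsFfg X) (e : X ⟶ F.obj X ⨿ A) :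
    ∃ (Z : T.Algebra) (_ : IsFfg Z) (h : Z ⟶ A) (e' : X ⟶ F.obj X ⨿ Z), bullet F h e' = e :=
  hX.exists_factor_map hT (preservesSiftedColimits_coprod (F.obj X)) e

/-- The equation obtained by renaming the variables along an isomorphism. -/
noncomputable def rename {X X' A : T.Algebra} (φ : X ≅ X') (e : X ⟶ F.obj X ⨿ A) :
    X' ⟶ F.obj X' ⨿ A :=
  φ.inv ≫ e ≫ coprod.map (F.map φ.hom) (𝟙 A)

theorem bullet_rename {X X' A B : T.Algebra} (φ : X ≅ X') (h : A ⟶ B) (e : X ⟶ F.obj X ⨿ A) :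
    bullet F h (rename φ e) = rename φ (bullet F h e) := by
  simp [bullet, rename]

/-- Solutions are invariant under renaming of variables. Weak functoriality applies because every
equation has its parameters in an ffg object. -/
theorem sol_rename (hT : PreservesFilteredColimitsOfSize.{u, u} T.toFunctor)
    (A : FfgElgotAlgebra F) {X X' : T.Algebra} (hX : IsFfg X) (hX' : IsFfg X') (φ : X ≅ X')
    (e : X ⟶ F.obj X ⨿ A.a) : φ.hom ≫ A.sol hX' (rename φ e) = A.sol hX e := by
  obtain ⟨Z, hZ, h, e', rfl⟩ := exists_bullet_eq hT hX e
  rw [← bullet_rename]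
  exact A.weak_functoriality hX hX' hZ e' (rename φ e') φ.hom (by simp [rename]) h

/-- Solution preservation can be checked up to isomorphism of the object of variables. -/
theorem preserves_of_iso (hT : PreservesFilteredColimitsOfSize.{u, u} T.toFunctor)
    {A B : FfgElgotAlgebra F} (g : A.a ⟶ B.a) {X X' : T.Algebra} (hX : IsFfg X) (hX' : IsFfg X')
    (φ : X ≅ X')
    (h : ∀ e : X' ⟶ F.obj X' ⨿ A.a, B.sol hX' (bullet F g e) = A.sol hX' e ≫ g)
    (e : X ⟶ F.obj X ⨿ A.a) : B.sol hX (bullet F g e) = A.sol hX e ≫ g := by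
  rw [← sol_rename hT B hX hX' φ, ← bullet_rename, h, ← Category.assoc, sol_rename hT A hX hX' φ]

/-- The ffg-Elgot structure induced along a jointly monic family of morphisms into ffg-Elgot
algebras that reflects the structure maps and the solutions. -/
def ofJointlyMono {ι : Type*} (A : ι → FfgElgotAlgebra F) {B : T.Algebra}
    (i : ∀ j, B ⟶ (A j).a)
    (hi : ∀ {Z : T.Algebra} {x y : Z ⟶ B}, (∀ j, x ≫ i j = y ≫ i j) → x = y)
    (str : F.obj B ⟶ B) (hstr : ∀ j, str ≫ i j = F.map (i j) ≫ (A j).str)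
    (sol : ∀ {X : T.Algebra}, IsFfg X → (X ⟶ F.obj X ⨿ B) → (X ⟶ B))
    (hsol : ∀ j {X : T.Algebra} (hX : IsFfg X) (e : X ⟶ F.obj X ⨿ B),
      sol hX e ≫ i j = (A j).sol hX (bullet F (i j) e)) : FfgElgotAlgebra F where
  a := B
  str := str
  sol := sol
  sol_eq hX e := by
    refine hi fun j => ?_
    rw [hsol, (A j).sol_eq, ← hsol]
    simp [bullet, hstr]
  weak_functoriality hX hY hZ e f m hm h := by
    refine hi fun j => ?_
    rw [Category.assoc, hsol, hsol, bullet_bullet, bullet_bullet]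
    exact (A j).weak_functoriality hX hY hZ e f m hm _
  compositionality hX hY e f := by
    refine hi fun j => ?_
    rw [Category.assoc, hsol, hsol, bullet_bullet, hsol, (A j).compositionality, square_bullet]

/-! ### Limits of ffg-Elgot algebras -/

instance : (forget F).ReflectsIsomorphisms where
  reflects {A B} g _ := by
    have : IsIso g.f := ‹IsIso ((forget F).map g)›
    refine ⟨⟨inv g.f, fun hX e => ?_⟩, Hom.ext (IsIso.hom_inv_id g.f),
      Hom.ext (IsIso.inv_hom_id g.f)⟩
    rw [← cancel_mono g.f, ← g.preserves, bullet_bullet, IsIso.inv_hom_id, bullet_id,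
      Category.assoc, IsIso.inv_hom_id, Category.comp_id]

section Limits

variable {J : Type u} [SmallCategory J] (K : J ⥤ FfgElgotAlgebra F)

/-- The projection of a cone in the variety to the carrier of one of the ffg-Elgot algebras. -/
def leg (c : Cone (K ⋙ forget F)) (j : J) : c.pt ⟶ (K.obj j).a := c.π.app j

theorem leg_comp (c : Cone (K ⋙ forget F)) {j j' : J} (f : j ⟶ j') :
    leg K c j ≫ (K.map f).f = leg K c j' := c.w f

/-- A cone in the variety over the carriers of a diagram of ffg-Elgot algebras. -/
def mkCone (Z : T.Algebra) (x : ∀ j, Z ⟶ (K.obj j).a)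
    (hx : ∀ {j j' : J} (f : j ⟶ j'), x j ≫ (K.map f).f = x j') : Cone (K ⋙ forget F) where
  pt := Z
  π :=
    { app := x
      naturality := fun _ _ f => (Category.id_comp _).trans (hx f).symm }

/-- The solution of an equation in a limit, computed componentwise. -/
noncomputable def solCone (c : Cone (K ⋙ forget F)) {X : T.Algebra} (hX : IsFfg X)
    (e : X ⟶ F.obj X ⨿ c.pt) : Cone (K ⋙ forget F) :=
  mkCone K X (fun j => (K.obj j).sol hX (bullet F (leg K c j) e)) fun f => by
    rw [← leg_comp K c f, ← bullet_bullet, (K.map f).preserves]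

/-- The structure map of a limit, computed componentwise. -/
def strCone (hT : PreservesFilteredColimitsOfSize.{u, u} T.toFunctor)
    (hF : PreservesSiftedColimits.{u} F) (c : Cone (K ⋙ forget F)) : Cone (K ⋙ forget F) :=
  mkCone K (F.obj c.pt) (fun j => F.map (leg K c j) ≫ (K.obj j).str) fun f => by
    rw [← leg_comp K c f, F.map_comp, Category.assoc, Category.assoc, Hom.map_str hT hF]

/-- The ffg-Elgot algebra structure on a limit of carriers. -/
noncomputable def limitAlgebra (hT : PreservesFilteredColimitsOfSize.{u, u} T.toFunctor)
    (hF : PreservesSiftedColimits.{u} F) {c : Cone (K ⋙ forget F)} (hc : IsLimit c) :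
    FfgElgotAlgebra F :=
  ofJointlyMono K.obj (leg K c) (fun h => hc.hom_ext h)
    (hc.lift (strCone K hT hF c)) (fun j => hc.fac (strCone K hT hF c) j)
    (fun hX e => hc.lift (solCone K c hX e)) (fun j _ hX e => hc.fac (solCone K c hX e) j)

/-- The cone of projections, which preserve solutions by construction. -/
noncomputable def limitCone (hT : PreservesFilteredColimitsOfSize.{u, u} T.toFunctor)
    (hF : PreservesSiftedColimits.{u} F) {c : Cone (K ⋙ forget F)} (hc : IsLimit c) : Cone K where
  pt := limitAlgebra K hT hF hc
  π :=
    { app := fun j => ⟨leg K c j, fun hX e => (hc.fac (solCone K c hX e) j).symm⟩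
      naturality := fun _ _ f => Hom.ext (c.π.naturality f) }

/-- Limits of ffg-Elgot algebras are formed in the variety. -/
noncomputable def limitConeIsLimit (hT : PreservesFilteredColimitsOfSize.{u, u} T.toFunctor)
    (hF : PreservesSiftedColimits.{u} F) {c : Cone (K ⋙ forget F)} (hc : IsLimit c) :
    IsLimit (limitCone K hT hF hc) where
  lift s := ⟨hc.lift ((forget F).mapCone s), fun {X} hX e => by
    let l : s.pt.a ⟶ c.pt := hc.lift ((forget F).mapCone s)
    have hl (j : J) : l ≫ leg K c j = (s.π.app j).f := hc.fac _ j
    refine hc.hom_ext fun j => (hc.fac (solCone K c hX _) j).trans ?_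
    change (K.obj j).sol hX (bullet F (leg K c j) (bullet F l e)) =
      (s.pt.sol hX e ≫ l) ≫ leg K c j
    rw [bullet_bullet, Category.assoc, hl]
    exact (s.π.app j).preserves hX e⟩
  fac s j := Hom.ext (hc.fac ((forget F).mapCone s) j)
  uniq s m hm := Hom.ext (hc.uniq ((forget F).mapCone s) m.f fun j => congrArg Hom.f (hm j))

theorem hasLimits (hT : PreservesFilteredColimitsOfSize.{u, u} T.toFunctor)
    (hF : PreservesSiftedColimits.{u} F) : HasLimitsOfSize.{u, u} (FfgElgotAlgebra F) where
  has_limits_of_shape _ _ :=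
    ⟨fun K => ⟨_, limitConeIsLimit K hT hF (limit.isLimit (K ⋙ forget F))⟩⟩

theorem preservesLimits_forget (hT : PreservesFilteredColimitsOfSize.{u, u} T.toFunctor)
    (hF : PreservesSiftedColimits.{u} F) : PreservesLimitsOfSize.{u, u} (forget F) where
  preservesLimitsOfShape :=
    { preservesLimit := fun {K} =>
        preservesLimit_of_preserves_limit_cone
          (limitConeIsLimit K hT hF (limit.isLimit (K ⋙ forget F)))
          (limit.isLimit (K ⋙ forget F)) }

end Limits

/-! ### Split coequalizers of ffg-Elgot algebras -/

section SplitCoequalizer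

variable {A B : FfgElgotAlgebra F} (f g : A ⟶ B) {C : T.Algebra} {π : B.a ⟶ C}
  (q : IsSplitCoequalizer f.f g.f π)

include q in
/-- Replacing the parameters of an equation by their chosen representatives does not change the
solution up to a map coequalizing `f` and `g`. -/
theorem sol_comp_coequalizer {X : T.Algebra} (hX : IsFfg X) (e : X ⟶ F.obj X ⨿ B.a)
    {D : T.Algebra} (k : B.a ⟶ D) (hk : f.f ≫ k = g.f ≫ k) :
    B.sol hX (bullet F (π ≫ q.rightSection) e) ≫ k = B.sol hX e ≫ k := by
  rw [← q.leftSection_top, ← bullet_bullet, f.preserves, Category.assoc, hk, ← Category.assoc,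
    ← g.preserves, bullet_bullet, q.leftSection_bottom, bullet_id]

/-- The ffg-Elgot algebra structure on a split coequalizer: parameters are lifted along the section
`C ⟶ B`, and the equation is solved in `B`. -/
noncomputable def coequalizerAlgebra (hT : PreservesFilteredColimitsOfSize.{u, u} T.toFunctor)
    (hF : PreservesSiftedColimits.{u} F) : FfgElgotAlgebra F where
  a := C
  str := F.map q.rightSection ≫ B.str ≫ π
  sol hX e := B.sol hX (bullet F q.rightSection e) ≫ π
  sol_eq {X} hX e := by
    -- `f` and `g` being morphisms of `F`-algebras makes `π` one as well.
    have hπ : B.str ≫ π = F.map π ≫ F.map q.rightSection ≫ B.str ≫ π := by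
      rw [← F.map_comp_assoc, ← q.leftSection_top, F.map_comp_assoc, ← Category.assoc (F.map f.f),
        ← Hom.map_str hT hF, Category.assoc, q.condition, ← Category.assoc A.str,
        Hom.map_str hT hF, Category.assoc, ← F.map_comp_assoc, q.leftSection_bottom]
      simp
    conv_lhs => rw [B.sol_eq]
    rw [bullet, Category.assoc, Category.assoc, Category.assoc]
    congr 1
    rw [coprod.map_map_assoc, Category.id_comp, Category.comp_id]
    apply coprod.hom_ext
    · rw [coprod.inl_map_assoc, coprod.inl_map_assoc, coprod.inl_desc, coprod.inl_desc_assoc,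
        F.map_comp_assoc, ← hπ]
    · rw [coprod.inr_map_assoc, coprod.inr_map_assoc, coprod.inr_desc, coprod.inr_desc_assoc,
        Category.id_comp, Category.id_comp, q.rightSection_π]
  weak_functoriality hX hY hZ e f' m hm h := by
    rw [bullet_bullet, bullet_bullet, ← Category.assoc, B.weak_functoriality hX hY hZ e f' m hm]
  compositionality hX hY e f' := by
    rw [← bullet_bullet F _ π, bullet_bullet F π, sol_comp_coequalizer f g q _ _ _ q.condition,
      B.compositionality, square_bullet, Category.assoc]

/-- The projection onto the split coequalizer, as a solution-preserving morphism. -/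
noncomputable def coequalizerHom (hT : PreservesFilteredColimitsOfSize.{u, u} T.toFunctor)
    (hF : PreservesSiftedColimits.{u} F) : B ⟶ coequalizerAlgebra f g q hT hF where
  f := π
  preserves hX e := by
    change B.sol hX (bullet F q.rightSection (bullet F π e)) ≫ π = _
    rw [bullet_bullet, sol_comp_coequalizer f g q _ _ _ q.condition]
    rfl

/-- The lifted split coequalizer. -/
noncomputable def coequalizerCofork (hT : PreservesFilteredColimitsOfSize.{u, u} T.toFunctor)
    (hF : PreservesSiftedColimits.{u} F) : Cofork f g :=
  Cofork.ofπ (coequalizerHom f g q hT hF) (Hom.ext q.condition)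

/-- Coequalizers of pairs that split in the variety are formed there. -/
noncomputable def coequalizerIsColimit
    (hT : PreservesFilteredColimitsOfSize.{u, u} T.toFunctor)
    (hF : PreservesSiftedColimits.{u} F) : IsColimit (coequalizerCofork f g q hT hF) :=
  Cofork.IsColimit.mk' _ fun c => by
    have hc : f.f ≫ c.π.f = g.f ≫ c.π.f := congrArg Hom.f c.condition
    have hπ : π ≫ q.rightSection ≫ c.π.f = c.π.f := by
      rw [← Category.assoc, ← q.leftSection_top, Category.assoc, hc, ← Category.assoc,
        q.leftSection_bottom, Category.id_comp]
    refine ⟨⟨q.rightSection ≫ c.π.f, fun hX e => ?_⟩, Hom.ext hπ, fun {m} hm => Hom.ext ?_⟩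
    · change _ = (B.sol hX (bullet F q.rightSection e) ≫ π) ≫ q.rightSection ≫ c.π.f
      rw [Category.assoc, hπ, ← c.π.preserves]
      exact congrArg _ (bullet_bullet F q.rightSection c.π.f e).symm
    · let n : C ⟶ c.pt.a := m.f
      have hm' : π ≫ n = c.π.f := congrArg Hom.f hm
      change n = q.rightSection ≫ c.π.f
      rw [← hm', ← Category.assoc, q.rightSection_π, Category.id_comp]

end SplitCoequalizer

theorem hasCoequalizerOfIsSplitPair (hT : PreservesFilteredColimitsOfSize.{u, u} T.toFunctor)
    (hF : PreservesSiftedColimits.{u} F) :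
    Monad.HasCoequalizerOfIsSplitPair (forget F) where
  out f g hfg := by
    obtain ⟨Z, π, ⟨q⟩⟩ := hfg.splittable
    exact ⟨_, coequalizerIsColimit f g q hT hF⟩

theorem preservesColimitOfIsSplitPair (hT : PreservesFilteredColimitsOfSize.{u, u} T.toFunctor)
    (hF : PreservesSiftedColimits.{u} F) :
    Monad.PreservesColimitOfIsSplitPair (forget F) where
  out f g hfg := by
    obtain ⟨Z, π, ⟨q⟩⟩ := hfg.splittable
    exact preservesColimit_of_preserves_colimit_cocone (coequalizerIsColimit f g q hT hF)
      ((isColimitMapCoconeCoforkEquiv (forget F) (Hom.ext q.condition)).symm q.isCoequalizer)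

/-! ### The solution set condition -/

section FfgIndex

/-- Indices for a small set of representatives of the ffg objects: finite lists of sorts, the
`i`-th entry being the sort of the `i`-th generator. -/
def FfgIndex (S : Type u) : Type u := Σ n : ℕ, Fin n → S

/-- The generators, grouped by their sorts. -/
def FfgIndex.sortedSet (k : FfgIndex S) : S → Type u := fun s => ULift {i : Fin k.1 // k.2 i = s}

/-- The free algebra on a list of sorted generators. -/
def FfgIndex.obj (T : Monad (S → Type u)) (k : FfgIndex S) : T.Algebra := T.free.obj k.sortedSet

theorem FfgIndex.isFfg_obj (T : Monad (S → Type u)) (k : FfgIndex S) : IsFfg (k.obj T) := by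
  refine ⟨k.sortedSet, ?_, ⟨Iso.refl _⟩⟩
  refine Finite.of_injective (β := Fin k.1) (fun t : Σ s, k.sortedSet s => t.2.down.1) ?_
  rintro ⟨s, ⟨i, hi⟩⟩ ⟨s', ⟨i', hi'⟩⟩ h
  dsimp only at h
  subst h hi hi'
  rfl

theorem FfgIndex.exists_iso {T : Monad (S → Type u)} {X : T.Algebra} (hX : IsFfg X) :
    ∃ k : FfgIndex S, Nonempty (X ≅ k.obj T) := by
  obtain ⟨X₀, hX₀, ⟨φ⟩⟩ := hX
  obtain ⟨n, ⟨ε⟩⟩ := Finite.exists_equiv_fin (Σ s, X₀ s)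
  let k : FfgIndex S := ⟨n, fun i => (ε.symm i).1⟩
  let equiv (s : S) : X₀ s ≃ k.sortedSet s :=
    (Equiv.sigmaSubtype s).symm.trans
      ((ε.subtypeEquiv fun t => by simp [k]).trans Equiv.ulift.symm)
  let ψ : X₀ ≅ k.sortedSet := Pi.isoMk fun s => (equiv s).toIso
  exact ⟨k, ⟨φ ≪≫ T.free.mapIso ψ⟩⟩

end FfgIndex

variable (F)

/-- The object `P` together with formal values of the structure map, and formal solutions of all
equations with parameters in `P`. -/
noncomputable def step (P : T.Algebra) : T.Algebra :=
  P ⨿ (F.obj P ⨿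
    ∐ fun t : (Σ k : FfgIndex S, k.obj T ⟶ F.obj (k.obj T) ⨿ P) => t.1.obj T)

/-- The terms of depth at most `n` over `Y` built from formal structure maps and solutions. No
equations are imposed between terms of different stages: only the inclusions are used. -/
noncomputable def stage (Y : T.Algebra) : ℕ → T.Algebra
  | 0 => Y
  | n + 1 => step F (stage Y n)

/-- The inclusion of a stage in the next one. -/
noncomputable def stageSucc (Y : T.Algebra) (n : ℕ) : stage F Y n ⟶ stage F Y (n + 1) :=
  (coprod.inl : _ ⟶ stage F Y n ⨿ _)

/-- The formal structure map from a stage to the next one. -/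
noncomputable def stageStr (Y : T.Algebra) (n : ℕ) :
    F.obj (stage F Y n) ⟶ stage F Y (n + 1) :=
  (coprod.inl ≫ coprod.inr : _ ⟶ stage F Y n ⨿ _)

/-- The formal solution, in the next stage, of an equation with parameters in a stage. -/
noncomputable def stageSol (Y : T.Algebra) (n : ℕ) (k : FfgIndex S)
    (e : k.obj T ⟶ F.obj (k.obj T) ⨿ stage F Y n) : k.obj T ⟶ stage F Y (n + 1) :=
  Sigma.ι (fun t : (Σ k : FfgIndex S, k.obj T ⟶ F.obj (k.obj T) ⨿ stage F Y n) => t.1.obj T)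
    ⟨k, e⟩ ≫ (coprod.inr ≫ coprod.inr : _ ⟶ stage F Y n ⨿ _)

/-- The chain of stages, indexed by a category in the universe of `T`. -/
noncomputable def chain (Y : T.Algebra) : AsSmall.{u} ℕ ⥤ T.Algebra :=
  AsSmall.down ⋙ Functor.ofSequence (stageSucc F Y)

variable {F}

section

variable {Y : T.Algebra} (A : FfgElgotAlgebra F) (h : Y ⟶ A.a)

/-- The interpretation of the formal operations of the stages in an ffg-Elgot algebra. -/
noncomputable def stageMap : ∀ n, stage F Y n ⟶ A.a
  | 0 => h
  | n + 1 => (coprod.desc (stageMap n) (coprod.desc (F.map (stageMap n) ≫ A.str)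
      (Sigma.desc fun t => A.sol (t.1.isFfg_obj T) (bullet F (stageMap n) t.2))) :
        stage F Y n ⨿ _ ⟶ A.a)

theorem stageSucc_stageMap (n : ℕ) :
    stageSucc F Y n ≫ stageMap A h (n + 1) = stageMap A h n :=
  coprod.inl_desc _ _

theorem stageStr_stageMap (n : ℕ) :
    stageStr F Y n ≫ stageMap A h (n + 1) = F.map (stageMap A h n) ≫ A.str := by
  refine (Category.assoc _ _ _).trans ?_
  exact (congrArg _ (coprod.inr_desc _ _)).trans (coprod.inl_desc _ _)

theorem stageSol_stageMap (n : ℕ) (k : FfgIndex S)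
    (e : k.obj T ⟶ F.obj (k.obj T) ⨿ stage F Y n) :
    stageSol F Y n k e ≫ stageMap A h (n + 1) =
      A.sol (k.isFfg_obj T) (bullet F (stageMap A h n) e) := by
  refine (Category.assoc _ _ _).trans ?_
  refine (congrArg _ (Category.assoc _ _ _)).trans ?_
  refine (congrArg _ (congrArg _ (coprod.inr_desc _ _))).trans ?_
  refine (congrArg _ (coprod.inr_desc _ _)).trans ?_
  exact Sigma.ι_desc _ _

/-- The interpretations of the stages are compatible. -/
noncomputable def chainCocone : Cocone (chain F Y) where
  pt := A.a
  ι := Functor.whiskerLeft AsSmall.down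
    (NatTrans.ofSequence (G := (Functor.const ℕ).obj A.a) (stageMap A h) fun n => by
      rw [Functor.ofSequence_map_homOfLE_succ]
      exact (stageSucc_stageMap A h n).trans (Category.comp_id _).symm)

/-- The union of the stages. -/
noncomputable def union (F : T.Algebra ⥤ T.Algebra) (Y : T.Algebra) : T.Algebra :=
  colimit (chain F Y)

/-- The inclusion of a stage in the union. -/
noncomputable def stageInc (F : T.Algebra ⥤ T.Algebra) (Y : T.Algebra) (n : ℕ) :
    stage F Y n ⟶ union F Y :=
  colimit.ι (chain F Y) (AsSmall.up.obj n)

/-- The interpretation of all terms in an ffg-Elgot algebra. -/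
noncomputable def unionMap : union F Y ⟶ A.a := colimit.desc (chain F Y) (chainCocone A h)

theorem stageInc_unionMap (n : ℕ) : stageInc F Y n ≫ unionMap A h = stageMap A h n :=
  colimit.ι_desc (chainCocone A h) (AsSmall.up.obj n)

instance isFiltered_asSmall : IsFiltered (AsSmall.{u} ℕ) := IsFiltered.of_equivalence AsSmall.equiv

instance isSifted_asSmall : IsSifted (AsSmall.{u} ℕ) := IsFiltered.isSifted

/-- Every quotient of the union of the stages through which the interpretation in `A` factors by a
monomorphism carries the structure map of `A`. -/
theorem exists_str (hF : PreservesSiftedColimits.{u} F) {B : T.Algebra} (q : union F Y ⟶ B)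
    (s : B.A ⟶ (union F Y).A) (hs : s ≫ q.f = 𝟙 _) (i : B ⟶ A.a) [Mono i]
    (hi : q ≫ i = unionMap A h) : ∃ str : F.obj B ⟶ B, str ≫ i = F.map i ≫ A.str := by
  have := hF (AsSmall.{u} ℕ)
  have hc := isColimitOfPreserves F (colimit.isColimit (chain F Y))
  let v (n : ℕ) : F.obj (stage F Y n) ⟶ B := stageStr F Y n ≫ stageInc F Y (n + 1) ≫ q
  have hv (n : ℕ) : v n ≫ i = F.map (stageMap A h n) ≫ A.str := by
    simp only [v, Category.assoc]
    rw [hi, stageInc_unionMap, stageStr_stageMap]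
  have hw {j j' : AsSmall.{u} ℕ} (f : j ⟶ j') :
      (chain F Y).map f ≫ stageMap A h (AsSmall.down.obj j') =
        stageMap A h (AsSmall.down.obj j) := (chainCocone A h).w f
  let t : Cocone (chain F Y ⋙ F) :=
    { pt := B
      ι :=
        { app := fun j => v (AsSmall.down.obj j)
          naturality := fun j j' f => by
            let c : stage F Y (AsSmall.down.obj j) ⟶ stage F Y (AsSmall.down.obj j') :=
              (chain F Y).map f
            have hcv : F.map c ≫ v (AsSmall.down.obj j') = v (AsSmall.down.obj j) := by
              have hc : c ≫ stageMap A h (AsSmall.down.obj j') =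
                  stageMap A h (AsSmall.down.obj j) := hw f
              rw [← cancel_mono i, Category.assoc, hv, hv, ← F.map_comp_assoc, hc]
            exact hcv.trans (Category.comp_id (v (AsSmall.down.obj j))).symm } }
  let d : F.obj (union F Y) ⟶ B := hc.desc t
  have hd : d ≫ i = F.map (unionMap A h) ≫ A.str := by
    refine hc.hom_ext fun j => ?_
    have h₁ : F.map (stageInc F Y (AsSmall.down.obj j)) ≫ d = v (AsSmall.down.obj j) := hc.fac t j
    have h₂ : F.map (stageInc F Y (AsSmall.down.obj j)) ≫ d ≫ i =
        F.map (stageInc F Y (AsSmall.down.obj j)) ≫ F.map (unionMap A h) ≫ A.str := by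
      rw [← Category.assoc, h₁, hv, ← F.map_comp_assoc, stageInc_unionMap]
    exact h₂
  -- `F q` is a strong epimorphism, so the structure map on terms descends along it.
  have := strongEpi_map hF q s hs
  have sq : CommSq d (F.map q) i (F.map i ≫ A.str) :=
    ⟨by rw [hd, ← hi, F.map_comp, Category.assoc]⟩
  exact ⟨sq.lift, sq.fac_right⟩

/-- The solutions in `A` of equations with parameters in such a quotient lie in the quotient: the
equation lifts to the union of the stages because its variables are free, and then to a single
stage because they are finitely generated. -/
theorem exists_sol (hT : PreservesFilteredColimitsOfSize.{u, u} T.toFunctor) {B : T.Algebra}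
    (q : union F Y ⟶ B) (s : B.A ⟶ (union F Y).A) (hs : s ≫ q.f = 𝟙 _) (i : B ⟶ A.a)
    (hi : q ≫ i = unionMap A h) {X : T.Algebra} (hX : IsFfg X) (e : X ⟶ F.obj X ⨿ B) :
    ∃ d : X ⟶ B, d ≫ i = A.sol hX (bullet F i e) := by
  obtain ⟨k, ⟨φ⟩⟩ := FfgIndex.exists_iso hX
  have hk := k.isFfg_obj T
  rw [← sol_rename hT A hX hk φ, ← bullet_rename]
  generalize rename φ e = e
  have hG := preservesSiftedColimits_coprod.{u} (F.obj (k.obj T))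
  have : StrongEpi (coprod.map (𝟙 (F.obj (k.obj T))) q) := strongEpi_map hG q s hs
  obtain ⟨e, rfl⟩ := hk.exists_hom_lift (coprod.map (𝟙 (F.obj (k.obj T))) q) e
  have := hG (AsSmall.{u} ℕ)
  have := hT.preserves_filtered_colimits (AsSmall.{u} ℕ)
  obtain ⟨n, e₀, rfl⟩ : ∃ (n : ℕ) (e₀ : k.obj T ⟶ F.obj (k.obj T) ⨿ stage F Y n),
      bullet F (stageInc F Y n) e₀ = e := by
    obtain ⟨j, e₀, he₀⟩ := hk.exists_factor (isColimitOfPreserves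
      (coprod.functor.obj (F.obj (k.obj T))) (colimit.isColimit (chain F Y))) e
    exact ⟨AsSmall.down.obj j, e₀, he₀⟩
  refine ⟨φ.hom ≫ stageSol F Y n k e₀ ≫ stageInc F Y (n + 1) ≫ q, ?_⟩
  change _ = φ.hom ≫ A.sol hk (bullet F i (bullet F q (bullet F (stageInc F Y n) e₀)))
  simp only [Category.assoc]
  rw [hi, stageInc_unionMap, stageSol_stageMap, bullet_bullet, bullet_bullet, hi,
    stageInc_unionMap]

end

/-- The sub-ffg-Elgot-algebra generated by `h : Y ⟶ A` is a quotient of the union of the stages. -/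
theorem exists_generated (hT : PreservesFilteredColimitsOfSize.{u, u} T.toFunctor)
    (hF : PreservesSiftedColimits.{u} F) {Y : T.Algebra} (A : FfgElgotAlgebra F) (h : Y ⟶ A.a) :
    ∃ (k : QuotAlgebra (union F Y)) (q : union F Y ⟶ k.toAlgebra) (E : FfgElgotAlgebra F)
      (φ : E.a ≅ k.toAlgebra) (i : k.toAlgebra ⟶ A.a), q ≫ i = unionMap A h ∧
      ∀ {X : T.Algebra} (hX : IsFfg X) (e : X ⟶ F.obj X ⨿ k.toAlgebra),
        A.sol hX (bullet F i e) = E.sol hX (bullet F φ.inv e) ≫ φ.hom ≫ i := by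
  obtain ⟨k, q, s, i, hs, hi, hmono⟩ := exists_image (unionMap A h)
  obtain ⟨str, hstr⟩ := exists_str A h hF q s hs i hi
  choose sol hsol using fun {X : T.Algebra} (hX : IsFfg X) (e : X ⟶ F.obj X ⨿ k.toAlgebra) =>
    exists_sol A h hT q s hs i hi hX e
  refine ⟨k, q, ofJointlyMono (fun _ : Unit => A) (fun _ => i)
    (fun hxy => (cancel_mono i).1 (hxy ())) str (fun _ => hstr) sol (fun _ _ => hsol),
    Iso.refl _, i, hi, fun hX e => ?_⟩
  change _ = sol hX (bullet F (𝟙 _) e) ≫ 𝟙 _ ≫ i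
  rw [bullet_id, Category.id_comp, hsol]

theorem solutionSetCondition_forget (hT : PreservesFilteredColimitsOfSize.{u, u} T.toFunctor)
    (hF : PreservesSiftedColimits.{u} F) : SolutionSetCondition.{u} (forget F) := by
  intro Y
  -- Quotients of the union of the stages, with the solutions of the equations over the skeleton;
  -- the latter determine an ffg-Elgot algebra up to isomorphism, so one choice for each suffices.
  let Pre : Type u := Σ k : QuotAlgebra (union F Y), (union F Y ⟶ k.toAlgebra) ×
    ∀ t : FfgIndex S, (t.obj T ⟶ F.obj (t.obj T) ⨿ k.toAlgebra) → (t.obj T ⟶ k.toAlgebra)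
  let ι : Type u := {d : Pre // ∃ (E : FfgElgotAlgebra F) (φ : E.a ≅ d.1.toAlgebra),
    ∀ t e, E.sol (t.isFfg_obj T) (bullet F φ.inv e) ≫ φ.hom = d.2.2 t e}
  let E (d : ι) : FfgElgotAlgebra F := d.2.choose
  let φ (d : ι) : (E d).a ≅ d.1.1.toAlgebra := d.2.choose_spec.choose
  have hE (d : ι) : ∀ t e, (E d).sol (t.isFfg_obj T) (bullet F (φ d).inv e) ≫ (φ d).hom =
    d.1.2.2 t e := d.2.choose_spec.choose_spec
  refine ⟨ι, E, fun d => stageInc F Y 0 ≫ d.1.2.1 ≫ (φ d).inv, fun A (h : Y ⟶ A.a) => ?_⟩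
  obtain ⟨k, q, E₀, φ₀, i, hi, hsol⟩ := exists_generated hT hF A h
  let d : ι := ⟨⟨k, q, fun t e => E₀.sol (t.isFfg_obj T) (bullet F φ₀.inv e) ≫ φ₀.hom⟩, E₀, φ₀,
    fun _ _ => rfl⟩
  have hd (t : FfgIndex S) (e : t.obj T ⟶ F.obj (t.obj T) ⨿ (E d).a) :
      A.sol (t.isFfg_obj T) (bullet F ((φ d).hom ≫ i) e) =
        (E d).sol (t.isFfg_obj T) e ≫ (φ d).hom ≫ i := by
    have := hE d t (bullet F (φ d).hom e)
    rw [bullet_bullet, Iso.hom_inv_id, bullet_id] at this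
    rw [← bullet_bullet, hsol, ← Category.assoc _ _ i, ← Category.assoc _ _ i, this]
  refine ⟨d, ⟨(φ d).hom ≫ i, fun hX e => ?_⟩, ?_⟩
  · obtain ⟨t, ⟨ψ⟩⟩ := FfgIndex.exists_iso hX
    exact preserves_of_iso hT _ hX (t.isFfg_obj T) ψ (hd t) e
  · change (stageInc F Y 0 ≫ q ≫ (φ d).inv) ≫ (φ d).hom ≫ i = h
    rw [Category.assoc, Category.assoc, Iso.inv_hom_id_assoc, hi]
    exact stageInc_unionMap A h 0

end FfgElgotAlgebra

theorem mainTheorem2 {S : Type u} (T : Monad (S → Type u))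
    (hT : PreservesFilteredColimitsOfSize.{u, u} T.toFunctor)
    (F : T.Algebra ⥤ T.Algebra)
    (hF : ∀ (J : Type u) [SmallCategory J] [IsSifted J], PreservesColimitsOfShape J F) :
    Nonempty (MonadicRightAdjoint (FfgElgotAlgebra.forget F)) := by
  have := FfgElgotAlgebra.hasLimits hT hF
  have := FfgElgotAlgebra.preservesLimits_forget hT hF
  have := FfgElgotAlgebra.hasCoequalizerOfIsSplitPair hT hF
  have := FfgElgotAlgebra.preservesColimitOfIsSplitPair hT hF
  have := isRightAdjoint_of_preservesLimits_of_solutionSetCondition _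
    (FfgElgotAlgebra.solutionSetCondition_forget hT hF)
  exact ⟨Monad.monadicOfHasPreservesGSplitCoequalizersOfReflectsIsomorphisms
    (Adjunction.ofIsRightAdjoint (FfgElgotAlgebra.forget F))⟩
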